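/- Let $(\mathbb{U},\rho)$ be the Urysohn space, i.e. the (unique up to isometry) complete separable metric space that is ultrahomogeneous (every isometry between two finite subspaces of $\mathbb{U}$ extends to an isometry of $\mathbb{U}$ onto itself) and universal (every complete separable metric space is isometric to a subspace of $\mathbb{U}$). Let $\mathcal{F}(\mathbb{U})$ be the set of all closed subsets of $\mathbb{U}$ with the Wijsman topology, the weakest topology for which the functionals $F\mapsto \rho(x,F)=\inf_{y\in F}\rho(x,y)\in[0,\infty]$, $x\in\mathbb{U}$, are all continuous (with $\rho(x,\emptyset)=\infty$). A Katětov map on a metric space $(X,d)$ is a function $g:X\to\mathbb{R}$ with $g(x)-g(y)\le d(x,y)\le g(x)+g(y)$ for all $x,y\in X$. Then for a generic $F\in\mathcal{F}(\mathbb{U})$, that is, for all $F$ in a comeager subset of $\mathcal{F}(\mathbb{U})$: 1. $F$ absorbs points: $F\neq\emptyset$, and for every finite $X\subset\mathbb{U}$ and every Katětov map $g$ on $X$ with $\rho(x,F)<g(x)$ for all $x\in X$, there is $z\in F$ with $\rho(z,x)=g(x)$ for all $x\in X$; 2. $F$ has the extension property: for every finite $A\subset F$ and every Katětov map $g$ on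 $A$ there is $z\in F$ with $\rho(z,a)=g(a)$ for all $a\in A$; 3. $F$ is isometric to $\mathbb{U}$. -/

import Mathlib

open TopologicalSpace

/-- A metric space `U` is (a copy of) the Urysohn space: it is a complete separable metric space
which is ultrahomogeneous and universal. Every complete separable metric space has at most
continuum many points, hence an isometric copy in `Type`; so quantifying over `Type` in `universal`
covers all of them. -/
structure IsUrysohnSpace (U : Type*) [MetricSpace U] : Prop where
  complete : CompleteSpace U
  separable : SeparableSpace U
  /-- Isometries between finite subspaces extend to isometries of the whole space. -/
  ultrahomogeneous : ∀ A B : Set U, A.Finite → B.Finite → ∀ f : A ≃ᵢ B,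
    ∃ g : U ≃ᵢ U, ∀ a : A, g a = f a
  /-- Every complete separable metric space embeds isometrically. -/
  universal : ∀ (X : Type) [MetricSpace X] [CompleteSpace X] [SeparableSpace X],
    ∃ i : X → U, Isometry i

/-- The Wijsman topology on the set of all closed subsets of `X`: the weakest topology that makes
all the functionals `F ↦ d(x, F)`, `x ∈ X`, continuous. The values lie in `[0, ∞]`, with
`d(x, ∅) = ∞`; at nonempty `F` they are the usual real distances. -/
noncomputable abbrev wijsmanTopology (X : Type*) [MetricSpace X] : TopologicalSpace (Closeds X) :=
  ⨅ x : X, TopologicalSpace.induced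
    (fun F : Closeds X => Metric.infEDist x (F : Set X)) inferInstance

/-- The property `P` holds for a generic closed subset of `X`: the set of closed sets with
this property is comeager in the Wijsman topology. -/
def ForGenericClosed {X : Type*} [MetricSpace X] (P : Closeds X → Prop) : Prop :=
  {F : Closeds X | P F} ∈ @residual (Closeds X) (wijsmanTopology X)

/-- Katětov maps on a metric space. -/
def IsKatetovMap {X : Type*} [MetricSpace X] (g : X → ℝ) : Prop :=
  ∀ x y : X, g x - g y ≤ dist x y ∧ dist x y ≤ g x + g y

/-- `D` absorbs points: it is nonempty, and every Katětov map `g` on a finite subset `A` of the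
ambient space with `d(a, D) < g a` for all `a ∈ A` is realized by the distances to a point of `D`. -/
def AbsorbsPoints {X : Type*} [MetricSpace X] (D : Set X) : Prop :=
  D.Nonempty ∧ ∀ A : Set X, A.Finite → ∀ g : A → ℝ, IsKatetovMap g →
    (∀ a : A, Metric.infDist (a : X) D < g a) → ∃ z ∈ D, ∀ a : A, dist z (a : X) = g a

/-- The extension property: every Katětov map on a finite subset of `X` is realized by the
distances to a point of `X`. -/
def HasExtensionProperty (X : Type*) [MetricSpace X] : Prop :=
  ∀ A : Set X, A.Finite → ∀ g : A → ℝ, IsKatetovMap g → ∃ z : X, ∀ a : A, dist z (a : X) = g a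

/-! For an open set `V`, the closed sets hitting `V` form a Wijsman-open set `O`, so a generic `F`
lies in `O` or outside its closure. Let `V` run over the countably many approximate spheres with
centres in a dense sequence and rational data. If `F` is nonempty and `g` is a Katětov map with
`d(x, F) ≤ g x`, the extension property of `U` gives a point realizing `g` whose addition to `F`
leaves finitely many chosen distances unchanged. Hence `F` lies in the closure of `O`, so `F` itself
hits `V`: it absorbs points approximately.

Completeness makes the absorption exact. On points of `F` the distance to `F` is zero, so absorption
yields the extension property, and a back-and-forth argument identifies `F` with `U`. -/

/-- A Katětov map on an indexed family of points. -/
def IsKatetovFamily {X ι : Type*} [MetricSpace X] (x : ι → X) (g : ι → ℝ) : Prop :=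
  ∀ i j, g i - g j ≤ dist (x i) (x j) ∧ dist (x i) (x j) ≤ g i + g j

theorem IsKatetovFamily.nonneg {X ι : Type*} [MetricSpace X] {x : ι → X} {g : ι → ℝ}
    (h : IsKatetovFamily x g) (i : ι) : 0 ≤ g i := by
  have := (h i i).2
  rw [dist_self] at this
  linarith

theorem isKatetovFamily_dist {X ι : Type*} [MetricSpace X] (x : ι → X) (z : X) :
    IsKatetovFamily x fun i => dist z (x i) := fun i j =>
  ⟨by linarith [dist_triangle z (x j) (x i), dist_comm (x i) (x j)],
    by linarith [dist_triangle (x i) z (x j), dist_comm (x i) z]⟩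

theorem HasExtensionProperty.exists_dist_eq {X ι : Type*} [MetricSpace X] [Finite ι]
    (hX : HasExtensionProperty X) {x : ι → X} {g : ι → ℝ} (h : IsKatetovFamily x g) :
    ∃ z, ∀ i, dist z (x i) = g i := by
  have key : ∀ i j, x i = x j → g i = g j := fun i j hij => by
    have h1 := (h i j).1
    have h2 := (h j i).1
    rw [hij, dist_self] at h1 h2
    linarith
  choose k hk using fun a : Set.range x => a.2
  obtain ⟨z, hz⟩ := hX (Set.range x) (Set.finite_range x) (fun a => g (k a)) (fun a b => by
    have := h (k a) (k b)
    rwa [hk, hk] at this)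
  refine ⟨z, fun i => ?_⟩
  rw [← key _ _ (hk ⟨x i, i, rfl⟩)]
  exact hz ⟨x i, i, rfl⟩

/-- The Kuratowski map embeds `A` in `Fin n → ℝ` with the sup metric, where `g` itself is a point at
distance `g a` from the image of `a`. Universality carries this into `U`, and ultrahomogeneity moves
the copy of `A` back onto `A`. -/
theorem IsUrysohnSpace.hasExtensionProperty {U : Type*} [MetricSpace U] (hU : IsUrysohnSpace U) :
    HasExtensionProperty U := by
  intro A hA g hg
  have hg0 : ∀ a, 0 ≤ g a := fun a => IsKatetovFamily.nonneg (x := fun a : A => (a : U)) hg a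
  have := hA.to_subtype
  obtain ⟨n, ⟨e⟩⟩ := Finite.exists_equiv_fin A
  obtain ⟨i, hi⟩ := hU.universal (Fin n → ℝ)
  have hκ : Isometry fun (a : A) (k : Fin n) => dist a (e.symm k) := by
    refine Isometry.of_dist_eq fun a b => le_antisymm ?_ ?_
    · refine (dist_pi_le_iff dist_nonneg).2 fun k => ?_
      rw [Real.dist_eq]
      exact abs_dist_sub_le _ _ _
    · refine le_trans ?_ (dist_le_pi_dist _ _ (e b))
      simp
  have hκg : ∀ a : A, dist (fun k => g (e.symm k)) (fun k : Fin n => dist a (e.symm k)) = g a := by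
    refine fun a => le_antisymm ?_ ?_
    · refine (dist_pi_le_iff (hg0 a)).2 fun k => ?_
      rw [Real.dist_eq, abs_le]
      have h1 := hg a (e.symm k)
      have h2 := hg (e.symm k) a
      rw [dist_comm (e.symm k) a] at h2
      constructor <;> linarith
    · refine le_trans ?_ (dist_le_pi_dist _ _ (e a))
      simp [le_abs_self]
  have hf := hi.comp hκ
  obtain ⟨φ, hφ⟩ := hU.ultrahomogeneous _ A (Set.finite_range _) hA hf.isometryEquivOnRange.symm
  refine ⟨φ (i fun k => g (e.symm k)), fun a => ?_⟩
  have h1 := hφ (hf.isometryEquivOnRange a)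
  rw [IsometryEquiv.symm_apply_apply] at h1
  rw [← h1, φ.dist_eq]
  exact (hi.dist_eq _ _).trans (hκg a)

/-! ### Back-and-forth -/

theorem Isometry.surjective_of_dense_subset_range {X Y : Type*} [MetricSpace X] [CompleteSpace X]
    [MetricSpace Y] {f : X → Y} (hf : Isometry f) {D : Set Y} (hD : Dense D)
    (h : D ⊆ Set.range f) : Function.Surjective f :=
  Set.range_eq_univ.1 <| Set.eq_univ_of_univ_subset <|
    hD.closure_eq ▸ closure_minimal h hf.isClosedEmbedding.isClosed_range

/-- A relation whose projections are dense and which preserves distances extends to an isometry. -/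
theorem nonempty_isometryEquiv_of_relation {X Y : Type*} [MetricSpace X] [MetricSpace Y]
    [CompleteSpace X] [CompleteSpace Y] {R : Set (X × Y)}
    (hR : ∀ p ∈ R, ∀ q ∈ R, dist p.1 q.1 = dist p.2 q.2)
    (h₁ : Dense (Prod.fst '' R)) (h₂ : Dense (Prod.snd '' R)) : Nonempty (X ≃ᵢ Y) := by
  have hC : ∀ p ∈ closure R, ∀ q ∈ closure R, dist p.1 q.1 = dist p.2 q.2 := by
    have hcl : IsClosed {r : (X × Y) × (X × Y) | dist r.1.1 r.2.1 = dist r.1.2 r.2.2} :=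
      isClosed_eq (by fun_prop) (by fun_prop)
    have hsub : closure (R ×ˢ R) ⊆ {r : (X × Y) × (X × Y) | dist r.1.1 r.2.1 = dist r.1.2 r.2.2} :=
      closure_minimal (fun r hr => hR _ hr.1 _ hr.2) hcl
    intro p hp q hq
    rw [closure_prod_eq] at hsub
    exact hsub (Set.mk_mem_prod hp hq)
  -- In the sup metric both projections of the closure are isometric; their ranges are closed and
  -- dense, so the closure is the graph of an isometry.
  have : CompleteSpace (closure R) := isClosed_closure.completeSpace_coe
  have hf₁ : Isometry fun p : closure R => p.1.1 := Isometry.of_dist_eq fun p q => by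
    rw [Subtype.dist_eq, Prod.dist_eq, ← hC p p.2 q q.2, max_self]
  have hf₂ : Isometry fun p : closure R => p.1.2 := Isometry.of_dist_eq fun p q => by
    rw [Subtype.dist_eq, Prod.dist_eq, hC p p.2 q q.2, max_self]
  have hs₁ := hf₁.surjective_of_dense_subset_range h₁ (by
    rintro _ ⟨p, hp, rfl⟩
    exact ⟨⟨p, subset_closure hp⟩, rfl⟩)
  have hs₂ := hf₂.surjective_of_dense_subset_range h₂ (by
    rintro _ ⟨p, hp, rfl⟩
    exact ⟨⟨p, subset_closure hp⟩, rfl⟩)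
  let e₁ : closure R ≃ᵢ X := ⟨Equiv.ofBijective _ ⟨hf₁.injective, hs₁⟩, hf₁⟩
  let e₂ : closure R ≃ᵢ Y := ⟨Equiv.ofBijective _ ⟨hf₂.injective, hs₂⟩, hf₂⟩
  exact ⟨e₁.symm.trans e₂⟩

/-- Finite partial isometries between two metric spaces. -/
def FinitePartialIsometry (X Y : Type*) [MetricSpace X] [MetricSpace Y] : Type _ :=
  {s : Finset (X × Y) // ∀ p ∈ s, ∀ q ∈ s, dist p.1 q.1 = dist p.2 q.2}

instance (X Y : Type*) [MetricSpace X] [MetricSpace Y] :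
    PartialOrder (FinitePartialIsometry X Y) :=
  inferInstanceAs (PartialOrder (Subtype _))

theorem FinitePartialIsometry.exists_le_mem {X Y : Type*} [MetricSpace X] [MetricSpace Y]
    (s : FinitePartialIsometry X Y) {r : X × Y} (hr : ∀ p ∈ s.1, dist r.1 p.1 = dist r.2 p.2) :
    ∃ t, s ≤ t ∧ r ∈ t.1 := by
  classical
  refine ⟨⟨insert r s.1, ?_⟩, Finset.subset_insert _ _, Finset.mem_insert_self _ _⟩
  intro p hp q hq
  rcases Finset.mem_insert.1 hp with rfl | hps <;> rcases Finset.mem_insert.1 hq with rfl | hqs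
  · simp
  · exact hr q hqs
  · rw [dist_comm, hr p hps, dist_comm]
  · exact s.2 p hps q hqs

theorem FinitePartialIsometry.exists_le_fst_eq {X Y : Type*} [MetricSpace X] [MetricSpace Y]
    (hY : HasExtensionProperty Y) (x : X) (s : FinitePartialIsometry X Y) :
    ∃ t, s ≤ t ∧ ∃ y, (x, y) ∈ t.1 := by
  have h := isKatetovFamily_dist (fun p : s.1 => p.1.1) x
  obtain ⟨y, hy⟩ := hY.exists_dist_eq (x := fun p : s.1 => p.1.2) (g := fun p => dist x p.1.1)
    fun p q => s.2 p p.2 q q.2 ▸ h p q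
  obtain ⟨t, hst, ht⟩ := s.exists_le_mem (r := (x, y)) fun p hp => (hy ⟨p, hp⟩).symm
  exact ⟨t, hst, y, ht⟩

theorem FinitePartialIsometry.exists_le_snd_eq {X Y : Type*} [MetricSpace X] [MetricSpace Y]
    (hX : HasExtensionProperty X) (y : Y) (s : FinitePartialIsometry X Y) :
    ∃ t, s ≤ t ∧ ∃ x, (x, y) ∈ t.1 := by
  have h := isKatetovFamily_dist (fun p : s.1 => p.1.2) y
  obtain ⟨x, hx⟩ := hX.exists_dist_eq (x := fun p : s.1 => p.1.1) (g := fun p => dist y p.1.2)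
    fun p q => (s.2 p p.2 q q.2).symm ▸ h p q
  obtain ⟨t, hst, ht⟩ := s.exists_le_mem (r := (x, y)) fun p hp => hx ⟨p, hp⟩
  exact ⟨t, hst, x, ht⟩

/-- Two complete separable metric spaces with the extension property are isometric. -/
theorem HasExtensionProperty.nonempty_isometryEquiv {X Y : Type*} [MetricSpace X] [MetricSpace Y]
    [CompleteSpace X] [CompleteSpace Y] [SeparableSpace X] [SeparableSpace Y]
    (hX : HasExtensionProperty X) (hY : HasExtensionProperty Y) : Nonempty (X ≃ᵢ Y) := by
  have : Nonempty X :=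
    ⟨(hX ∅ Set.finite_empty (fun _ => 0) fun x => x.2.elim).choose⟩
  have : Nonempty Y :=
    ⟨(hY ∅ Set.finite_empty (fun _ => 0) fun x => x.2.elim).choose⟩
  -- An ideal meeting these countably many cofinal sets has a union whose projections contain both
  -- dense sequences.
  let D : ℕ ⊕ ℕ → Order.Cofinal (FinitePartialIsometry X Y) := Sum.elim
    (fun n => ⟨{t | ∃ y, (denseSeq X n, y) ∈ t.1}, fun s =>
      let ⟨t, h, ht⟩ := s.exists_le_fst_eq hY (denseSeq X n); ⟨t, ht, h⟩⟩)
    (fun n => ⟨{t | ∃ x, (x, denseSeq Y n) ∈ t.1}, fun s =>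
      let ⟨t, h, ht⟩ := s.exists_le_snd_eq hX (denseSeq Y n); ⟨t, ht, h⟩⟩)
  let I := Order.idealOfCofinals ⟨∅, by simp⟩ D
  refine nonempty_isometryEquiv_of_relation (R := {p | ∃ s ∈ I, p ∈ s.1}) ?_ ?_ ?_
  · rintro p ⟨s, hs, hp⟩ q ⟨t, ht, hq⟩
    obtain ⟨u, -, hsu, htu⟩ := I.directed s hs t ht
    exact u.2 p (hsu hp) q (htu hq)
  · refine (denseRange_denseSeq X).mono ?_
    rintro _ ⟨n, rfl⟩
    obtain ⟨s, ⟨y, hy⟩, hs⟩ := Order.cofinal_meets_idealOfCofinals ⟨∅, by simp⟩ D (Sum.inl n)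
    exact ⟨_, ⟨s, hs, hy⟩, rfl⟩
  · refine (denseRange_denseSeq Y).mono ?_
    rintro _ ⟨n, rfl⟩
    obtain ⟨s, ⟨x, hx⟩, hs⟩ := Order.cofinal_meets_idealOfCofinals ⟨∅, by simp⟩ D (Sum.inr n)
    exact ⟨_, ⟨s, hs, hx⟩, rfl⟩

/-! ### From approximate to exact absorption -/

theorem AbsorbsPoints.hasExtensionProperty {X : Type*} [MetricSpace X] {F : Set X}
    (hF : AbsorbsPoints F) : HasExtensionProperty F := by
  intro A hA g hg
  have hg0 : ∀ a, 0 ≤ g a := fun a => IsKatetovFamily.nonneg (x := fun a : A => (a : F)) hg a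
  -- A zero of `g` is itself the required point; otherwise `g` is strictly above the distance to
  -- `F`, which vanishes on `A`.
  by_cases h0 : ∃ a, g a = 0
  · obtain ⟨a, ha⟩ := h0
    refine ⟨a, fun b => ?_⟩
    have h1 := (hg a b).2
    have h2 := (hg b a).1
    rw [dist_comm] at h2
    change dist (a : F) (b : F) ≤ _ at h1
    change _ ≤ dist (a : F) (b : F) at h2
    linarith
  · push Not at h0
    let e : A ≃ ((↑) '' A : Set X) := Equiv.Set.image _ A Subtype.val_injective
    obtain ⟨z, hz, h⟩ := hF.2 ((↑) '' A) (hA.image _) (g ∘ e.symm) (fun x y => by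
        obtain ⟨a, rfl⟩ := e.surjective x
        obtain ⟨b, rfl⟩ := e.surjective y
        simp only [Function.comp_apply, Equiv.symm_apply_apply]
        exact hg a b) (fun x => by
        obtain ⟨a, rfl⟩ := e.surjective x
        rw [Function.comp_apply, Equiv.symm_apply_apply]
        refine lt_of_le_of_lt ?_ (lt_of_le_of_ne (hg0 a) (h0 a).symm)
        exact (Metric.infDist_zero_of_mem a.1.2).le)
    refine ⟨⟨z, hz⟩, fun a => ?_⟩
    have := h (e a)
    rwa [Function.comp_apply, Equiv.symm_apply_apply] at this

/-- `F` approximately absorbs points. -/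
def ApproximatelyAbsorbsPoints {X : Type*} [MetricSpace X] (F : Set X) : Prop :=
  ∀ (n : ℕ) (x : Fin n → X) (g : Fin n → ℝ), IsKatetovFamily x g →
    (∀ i, Metric.infDist (x i) F ≤ g i) → ∀ ε > 0, ∃ z ∈ F, ∀ i, |dist z (x i) - g i| < ε

/-- The approximate solution `z` joins the base points with prescribed distance `ε`, so the better
solution `w` stays near it. The bound `ε ≤ g i` keeps the enlarged family Katětov. -/
theorem ApproximatelyAbsorbsPoints.exists_near {X : Type*} [MetricSpace X] {F : Set X}
    (hF : ApproximatelyAbsorbsPoints F) {n : ℕ} {x : Fin n → X} {g : Fin n → ℝ}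
    (hg : IsKatetovFamily x g) (hd : ∀ i, Metric.infDist (x i) F ≤ g i) {ε δ : ℝ} (hε : 0 < ε)
    (hδ : 0 < δ) (hεg : ∀ i, ε ≤ g i) {z : X} (hz : z ∈ F) (hzg : ∀ i, |dist z (x i) - g i| ≤ ε) :
    ∃ w ∈ F, (∀ i, |dist w (x i) - g i| ≤ δ) ∧ dist z w ≤ ε + δ := by
  obtain ⟨w, hw, h⟩ := hF (n + 1) (Fin.cons z x) (Fin.cons ε g) (by
    intro i j
    refine Fin.cases ?_ (fun i => ?_) i <;> refine Fin.cases ?_ (fun j => ?_) j <;>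
      simp only [Fin.cons_zero, Fin.cons_succ]
    · rw [dist_self]; constructor <;> linarith
    · have := abs_le.1 (hzg j)
      have := hεg j
      constructor <;> linarith
    · have := abs_le.1 (hzg i)
      have := hεg i
      rw [dist_comm]
      constructor <;> linarith
    · exact hg i j) (by
    refine Fin.cases ?_ (fun i => ?_)
    · simpa [Metric.infDist_zero_of_mem hz] using hε.le
    · simpa using hd i) δ hδ
  refine ⟨w, hw, fun i => by simpa using (h i.succ).le, ?_⟩
  have := abs_lt.1 (h 0)
  simp only [Fin.cons_zero] at this
  rw [dist_comm]
  linarith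

theorem ApproximatelyAbsorbsPoints.exists_dist_eq {X : Type*} [MetricSpace X] [CompleteSpace X]
    {F : Set X} (hF : ApproximatelyAbsorbsPoints F) (hcl : IsClosed F) {n : ℕ} {x : Fin n → X}
    {g : Fin n → ℝ} (hg : IsKatetovFamily x g) (hd : ∀ i, Metric.infDist (x i) F ≤ g i)
    (hpos : ∀ i, 0 < g i) : ∃ z ∈ F, ∀ i, dist z (x i) = g i := by
  obtain ⟨c, hc, hcg⟩ : ∃ c > 0, ∀ i, c ≤ g i := by
    rcases isEmpty_or_nonempty (Fin n) with h | h
    · exact ⟨1, one_pos, fun i => h.elim i⟩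
    · obtain ⟨i, hi⟩ := exists_eq_ciInf_of_finite (f := g)
      exact ⟨g i, hpos i, fun j => hi ▸ ciInf_le (Set.finite_range g).bddBelow j⟩
  -- Starting at `c ≤ g i` keeps every error admissible for `exists_near`; geometric decay makes the
  -- successive solutions Cauchy.
  let e : ℕ → ℝ := fun k => c * (1 / 2) ^ k
  have he : ∀ k, 0 < e k := fun k => by positivity
  have hes : ∀ k, e (k + 1) = e k / 2 := fun k => by simp only [e, pow_succ]; ring
  have hec : ∀ k, e k ≤ c := fun k =>
    mul_le_of_le_one_right hc.le (pow_le_one₀ (by norm_num) (by norm_num))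
  let S : ℕ → Type _ := fun k => {z : X // z ∈ F ∧ ∀ i, |dist z (x i) - g i| ≤ e k}
  have hstep : ∀ k (z : S k), ∃ w : S (k + 1), dist z.1 w.1 ≤ e k + e (k + 1) := fun k z =>
    let ⟨w, hw, h1, h2⟩ := hF.exists_near hg hd (he k) (he (k + 1))
      (fun i => (hec k).trans (hcg i)) z.2.1 z.2.2
    ⟨⟨w, hw, h1⟩, h2⟩
  obtain ⟨z₀, hz₀, h₀⟩ := hF n x g hg hd (e 0) (he 0)
  choose next hnext using hstep
  let s : ∀ k, S k := fun k => Nat.rec ⟨z₀, hz₀, fun i => (h₀ i).le⟩ next k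
  have hs : ∀ k, dist (s k).1 (s (k + 1)).1 ≤ 2 * c * (1 / 2) ^ k := fun k => by
    refine (hnext k (s k)).trans ?_
    have := he k
    rw [hes]
    simp only [e] at this ⊢
    linarith
  obtain ⟨z, hz⟩ := cauchySeq_tendsto_of_complete
    (cauchySeq_of_le_geometric (1 / 2) (2 * c) (by norm_num) hs)
  refine ⟨z, hcl.mem_of_tendsto hz (Filter.Eventually.of_forall fun k => (s k).2.1), fun i => ?_⟩
  have h1 : Filter.Tendsto e Filter.atTop (nhds 0) := by
    simpa [e] using (tendsto_pow_atTop_nhds_zero_of_lt_one (r := (1 / 2 : ℝ)) (by norm_num)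
      (by norm_num)).const_mul c
  have h2 := squeeze_zero (fun k => abs_nonneg _) (fun k => (s k).2.2 i) h1
  have h3 := ((hz.dist (tendsto_const_nhds (x := x i))).sub_const (g i)).abs
  have h4 := tendsto_nhds_unique h3 h2
  exact sub_eq_zero.1 (abs_eq_zero.1 h4)

theorem ApproximatelyAbsorbsPoints.absorbsPoints {X : Type*} [MetricSpace X] [CompleteSpace X]
    {F : Set X} (hF : ApproximatelyAbsorbsPoints F) (hcl : IsClosed F) : AbsorbsPoints F := by
  refine ⟨?_, fun A hA g hg hd => ?_⟩
  · obtain ⟨z, hz, -⟩ := hF 0 Fin.elim0 Fin.elim0 (fun i => i.elim0) (fun i => i.elim0) 1 one_pos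
    exact ⟨z, hz⟩
  · have := hA.to_subtype
    obtain ⟨n, ⟨e⟩⟩ := Finite.exists_equiv_fin A
    obtain ⟨z, hz, h⟩ := hF.exists_dist_eq hcl (x := fun i => (e.symm i : X))
      (g := fun i => g (e.symm i)) (fun i j => hg _ _) (fun i => (hd _).le)
      (fun i => Metric.infDist_nonneg.trans_lt (hd _))
    exact ⟨z, hz, fun a => by simpa using h (e a)⟩

/-! ### Points realizing extreme distances -/

theorem HasExtensionProperty.exists_maximal_dist {X ι : Type*} [MetricSpace X] [Finite ι]
    [Nonempty ι] (hX : HasExtensionProperty X) {x : ι → X} {g : ι → ℝ} (hg : IsKatetovFamily x g)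
    {S : Set X} (hS : S.Finite) :
    ∃ w, (∀ i, dist w (x i) = g i) ∧ ∀ y ∈ S, ∃ i, dist w y = g i + dist (x i) y := by
  -- This is the largest 1-Lipschitz extension of `g`; the finite infimum is attained.
  let h : X → ℝ := fun u => ⨅ i, (g i + dist (x i) u)
  have hle : ∀ u i, h u ≤ g i + dist (x i) u := fun u i =>
    ciInf_le (Set.finite_range _).bddBelow i
  have hex : ∀ u, ∃ i, h u = g i + dist (x i) u := fun u =>
    let ⟨i, hi⟩ := exists_eq_ciInf_of_finite (f := fun i => g i + dist (x i) u)
    ⟨i, hi.symm⟩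
  have hx : ∀ i, h (x i) = g i := fun i => by
    refine le_antisymm (by simpa using hle (x i) i) ?_
    obtain ⟨j, hj⟩ := hex (x i)
    rw [hj]
    linarith [(hg i j).1, dist_comm (x i) (x j)]
  have hK : ∀ u v, h u - h v ≤ dist u v ∧ dist u v ≤ h u + h v := fun u v => by
    obtain ⟨i, hi⟩ := hex u
    obtain ⟨j, hj⟩ := hex v
    have := hle u j
    have := (hg i j).2
    have := dist_triangle (x j) v u
    have := dist_triangle4 u (x i) (x j) v
    rw [dist_comm u (x i)] at this
    constructor
    · linarith [dist_comm u v]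
    · linarith
  have := hS.to_subtype
  obtain ⟨w, hw⟩ := hX.exists_dist_eq (x := (Sum.elim x (↑) : ι ⊕ S → X))
    (g := fun k => h (Sum.elim x (↑) k)) fun _ _ => hK _ _
  refine ⟨w, fun i => ?_, fun y hy => ?_⟩
  · exact (hw (Sum.inl i)).trans (hx i)
  · obtain ⟨i, hi⟩ := hex y
    exact ⟨i, (hw (Sum.inr ⟨y, hy⟩)).trans hi⟩

theorem HasExtensionProperty.exists_far {X : Type*} [MetricSpace X]
    (hX : HasExtensionProperty X) {S : Set X} (hS : S.Finite) (R : ℝ) :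
    ∃ w, ∀ y ∈ S, R ≤ dist w y := by
  have := hS.to_subtype
  obtain ⟨C, hC⟩ := (Set.finite_range fun p : S × S => dist p.1.1 p.2.1).bddAbove
  have hC' : ∀ a b : S, dist (a : X) b ≤ C := fun a b => hC ⟨(a, b), rfl⟩
  -- A constant is Katětov once it is at least half the diameter of `S`.
  obtain ⟨w, hw⟩ := hX.exists_dist_eq (x := fun a : S => (a : X)) (g := fun _ => max R C)
    fun a b => by
      have := hC' a b
      have := le_max_right R C
      have h0 := dist_nonneg (x := (a : X)) (y := b)
      constructor <;> linarith
  exact ⟨w, fun y hy => (le_max_left R C).trans (hw ⟨y, hy⟩).ge⟩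

/-! ### Closures in the Wijsman topology -/

theorem IsOpen.union_compl_closure_mem_residual {α : Type*} [TopologicalSpace α] {O : Set α}
    (hO : IsOpen O) : O ∪ (closure O)ᶜ ∈ residual α := by
  refine residual_of_dense_open (hO.union isClosed_closure.isOpen_compl) ?_
  rw [dense_iff_closure_eq, closure_union, ← Set.univ_subset_iff, ← Set.union_compl_self (closure O)]
  exact Set.union_subset_union_right _ subset_closure

theorem continuous_infEDist_wijsman {X : Type*} [MetricSpace X] (x : X) :
    @Continuous _ _ (wijsmanTopology X) _ fun F : Closeds X => Metric.infEDist x (F : Set X) :=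
  continuous_iInf_dom (i := x) continuous_induced_dom

theorem isOpen_wijsman_hitting {X : Type*} [MetricSpace X] {V : Set X} (hV : IsOpen V) :
    @IsOpen _ (wijsmanTopology X) {F : Closeds X | ((F : Set X) ∩ V).Nonempty} := by
  let := wijsmanTopology X
  refine isOpen_iff_forall_mem_open.2 ?_
  rintro F ⟨z, hzF, hzV⟩
  obtain ⟨δ, hδ, h⟩ := EMetric.isOpen_iff.1 hV z hzV
  refine ⟨{F' : Closeds X | Metric.infEDist z (F' : Set X) < δ}, fun F' hF' => ?_,
    isOpen_Iio.preimage (continuous_infEDist_wijsman z), ?_⟩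
  · obtain ⟨y, hy, hd⟩ := Metric.infEDist_lt_iff.1 hF'
    exact ⟨y, hy, h (by rwa [Metric.mem_eball, edist_comm])⟩
  · change Metric.infEDist z (F : Set X) < δ
    rwa [Metric.infEDist_zero_of_mem hzF]

theorem exists_finite_of_mem_nhds_wijsman {X : Type*} [MetricSpace X] {F : Closeds X}
    {N : Set (Closeds X)} (hN : N ∈ @nhds _ (wijsmanTopology X) F) :
    ∃ (S : Set X) (W : X → Set ENNReal), S.Finite ∧
      (∀ y, W y ∈ nhds (Metric.infEDist y (F : Set X))) ∧
      ∀ F' : Closeds X, (∀ y ∈ S, Metric.infEDist y (F' : Set X) ∈ W y) → F' ∈ N := by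
  simp only [nhds_iInf, nhds_induced] at hN
  obtain ⟨S, hS, V, hV, -, hNV, -⟩ := Filter.mem_iInf'.1 hN
  choose W hW hWV using hV
  exact ⟨S, W, hS, hW, fun F' hF' => hNV ▸ Set.mem_iInter₂.2 fun y hy => hWV y (hF' y hy)⟩

/-- Finitely many test points cannot tell the empty set from a singleton far from all of them. -/
theorem HasExtensionProperty.bot_mem_closure_wijsman {X : Type*} [MetricSpace X]
    (hX : HasExtensionProperty X) :
    (⊥ : Closeds X) ∈ @closure _ (wijsmanTopology X) {F | (F : Set X).Nonempty} := by
  let := wijsmanTopology X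
  refine mem_closure_iff_nhds.2 fun N hN => ?_
  obtain ⟨S, W, hS, hW, hN⟩ := exists_finite_of_mem_nhds_wijsman hN
  have hR : ∀ y, ∃ R : NNReal, Set.Ioi (R : ENNReal) ⊆ W y := fun y => by
    have h := hW y
    rw [Closeds.coe_bot, Metric.infEDist_empty] at h
    exact ENNReal.nhds_top_basis.mem_iff.1 h |>.elim fun a ha =>
      ⟨a.toNNReal, by rw [ENNReal.coe_toNNReal ha.1.ne]; exact ha.2⟩
  choose R hR using hR
  obtain ⟨C, hC⟩ := (hS.image R).bddAbove
  obtain ⟨w, hw⟩ := hX.exists_far hS (C + 1)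
  refine ⟨({w} : Closeds X), hN _ fun y hy => hR y ?_, ⟨w, rfl⟩⟩
  rw [Closeds.coe_singleton, Metric.infEDist_singleton, edist_nndist, Set.mem_Ioi, ENNReal.coe_lt_coe,
    nndist_comm]
  refine (hC ⟨y, hy, rfl⟩).trans_lt (NNReal.coe_lt_coe.1 ?_)
  rw [coe_nndist]
  linarith [hw y hy]

theorem HasExtensionProperty.mem_closure_wijsman {X ι : Type*} [MetricSpace X] [Finite ι]
    [Nonempty ι] (hX : HasExtensionProperty X) {F : Closeds X} (hF : (F : Set X).Nonempty)
    {x : ι → X} {g : ι → ℝ} (hg : IsKatetovFamily x g)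
    (hd : ∀ i, Metric.infDist (x i) (F : Set X) ≤ g i) {V : Set X}
    (hV : ∀ w, (∀ i, dist w (x i) = g i) → w ∈ V) :
    F ∈ @closure _ (wijsmanTopology X) {F' | ((F' : Set X) ∩ V).Nonempty} := by
  let := wijsmanTopology X
  refine mem_closure_iff_nhds.2 fun N hN => ?_
  obtain ⟨S, W, hS, hW, hN⟩ := exists_finite_of_mem_nhds_wijsman hN
  obtain ⟨w, hwx, hwS⟩ := hX.exists_maximal_dist hg hS
  -- For `y ∈ S` some `i` gives `d(w, y) = g i + d(x i, y) ≥ d(x i, F) + d(x i, y) ≥ d(y, F)`, so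
  -- adding `w` does not change `d(y, F)`.
  refine ⟨F ⊔ ({w} : Closeds X), hN _ fun y hy => ?_, w, Or.inr rfl, hV w hwx⟩
  have hle : Metric.infEDist y (F : Set X) ≤ edist y w := by
    obtain ⟨i, hi⟩ := hwS y hy
    rw [edist_dist, ← ENNReal.ofReal_toReal (Metric.infEDist_ne_top (x := y) hF)]
    refine ENNReal.ofReal_le_ofReal ?_
    have h1 := Metric.infDist_le_infDist_add_dist (s := (F : Set X)) (x := y) (y := x i)
    have h2 := hd i
    change Metric.infDist y (F : Set X) ≤ _
    rw [dist_comm y w]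
    linarith [dist_comm y (x i)]
  rw [Closeds.coe_sup, Closeds.coe_singleton, Metric.infEDist_union, Metric.infEDist_singleton,
    inf_eq_left.2 hle]
  exact mem_of_mem_nhds (hW y)

/-! ### Genericity -/

/-- The points whose distances to the members of a dense sequence indexed by `s` are prescribed up
to an error `ε`. -/
def approximateSphere (X : Type*) [MetricSpace X] [SeparableSpace X] [Nonempty X]
    (s : Finset (ℕ × ℚ)) (ε : ℚ) : Set X :=
  ⋂ p ∈ s, {z | |dist z (denseSeq X p.1) - p.2| < ε}

theorem isOpen_approximateSphere (X : Type*) [MetricSpace X] [SeparableSpace X] [Nonempty X]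
    (s : Finset (ℕ × ℚ)) (ε : ℚ) : IsOpen (approximateSphere X s ε) :=
  isOpen_biInter_finset fun _ _ => isOpen_lt (by fun_prop) continuous_const

theorem exists_approximateSphere {X : Type*} [MetricSpace X] [SeparableSpace X] [Nonempty X]
    {n : ℕ} (x : Fin n → X) (g : Fin n → ℝ) {ε : ℝ} (hε : 0 < ε) :
    ∃ s δ, (∀ w, (∀ i, dist w (x i) = g i) → w ∈ approximateSphere X s δ) ∧
      ∀ w ∈ approximateSphere X s δ, ∀ i, |dist w (x i) - g i| < ε := by
  classical
  -- Moving a centre and rounding a radius cost `δ / 2` each; with the tolerance `δ` the total is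
  -- below `2 * δ < ε`.
  obtain ⟨δ, hδ0, hδε⟩ := exists_rat_btwn (half_pos hε)
  have hq : ∀ i, ∃ k, dist (x i) (denseSeq X k) < δ / 2 := fun i =>
    (denseRange_denseSeq X).exists_dist_lt (x i) (half_pos hδ0)
  have hr : ∀ i, ∃ r : ℚ, |g i - r| < δ / 2 := fun i => exists_rat_near _ (half_pos hδ0)
  choose q hq using hq
  choose r hr using hr
  have hdist : ∀ w i, |dist w (x i) - dist w (denseSeq X (q i))| < δ / 2 := fun w i => by
    rw [dist_comm w, dist_comm w]
    exact (abs_dist_sub_le _ _ _).trans_lt (hq i)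
  refine ⟨Finset.univ.image fun i => (q i, r i), δ, fun w hw => ?_, fun w hw i => ?_⟩
  · refine Set.mem_iInter₂.2 fun p hp => ?_
    obtain ⟨i, -, rfl⟩ := Finset.mem_image.1 hp
    change |dist w (denseSeq X (q i)) - r i| < δ
    have h1 := abs_lt.1 (hdist w i)
    have h2 := abs_lt.1 (hr i)
    rw [hw i] at h1
    exact abs_lt.2 ⟨by linarith, by linarith⟩
  · have h : |dist w (denseSeq X (q i)) - r i| < δ :=
      Set.mem_iInter₂.1 hw (q i, r i) (Finset.mem_image_of_mem _ (Finset.mem_univ i))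
    have h0 := abs_lt.1 h
    have h1 := abs_lt.1 (hdist w i)
    have h2 := abs_lt.1 (hr i)
    exact abs_lt.2 ⟨by linarith, by linarith⟩

theorem HasExtensionProperty.forGenericClosed_approximatelyAbsorbsPoints {X : Type*}
    [MetricSpace X] [SeparableSpace X] (hX : HasExtensionProperty X) :
    ForGenericClosed fun F : Closeds X => ApproximatelyAbsorbsPoints (F : Set X) := by
  let := wijsmanTopology X
  have : Nonempty X :=
    ⟨(hX ∅ Set.finite_empty (fun _ => 0) fun x => x.2.elim).choose⟩
  have hres : ∀ p : Finset (ℕ × ℚ) × ℚ, ∀ᶠ F : Closeds X in residual (Closeds X),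
      ((F : Set X) ∩ approximateSphere X p.1 p.2).Nonempty ∨
        F ∉ closure {F' : Closeds X | ((F' : Set X) ∩ approximateSphere X p.1 p.2).Nonempty} :=
    fun p => (isOpen_wijsman_hitting
      (isOpen_approximateSphere X p.1 p.2)).union_compl_closure_mem_residual
  change ∀ᶠ F : Closeds X in residual (Closeds X), ApproximatelyAbsorbsPoints (F : Set X)
  filter_upwards [eventually_countable_forall.2 hres] with F hF n x g hg hd ε hε
  have hne : (F : Set X).Nonempty := by
    by_contra h
    have hbot : F = ⊥ := Closeds.ext (Set.not_nonempty_iff_eq_empty.1 h)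
    -- With no constraints the approximate sphere is the whole space, so this condition excludes the
    -- empty set.
    have h1 := hF (∅, 1)
    simp only [approximateSphere, Finset.notMem_empty, Set.iInter_of_empty, Set.iInter_univ,
      Set.inter_univ] at h1
    exact h1.elim h (not_not.2 (hbot ▸ hX.bot_mem_closure_wijsman))
  rcases n.eq_zero_or_pos with rfl | hn
  · exact hne.imp fun z hz => ⟨hz, fun i => i.elim0⟩
  · have := Fin.pos_iff_nonempty.1 hn
    obtain ⟨s, δ, h1, h2⟩ := exists_approximateSphere x g hε
    obtain ⟨z, hz, hzs⟩ := (hF (s, δ)).resolve_right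
      (not_not.2 (hX.mem_closure_wijsman hne hg hd h1))
    exact ⟨z, hz, h2 z hzs⟩

theorem mainTheorem3 {U : Type*} [MetricSpace U] (hU : IsUrysohnSpace U) :
    ForGenericClosed (fun F : Closeds U =>
      AbsorbsPoints (F : Set U) ∧ HasExtensionProperty F ∧ Nonempty (F ≃ᵢ U)) := by
  have := hU.complete
  have := hU.separable
  have hext := hU.hasExtensionProperty
  refine Filter.mem_of_superset hext.forGenericClosed_approximatelyAbsorbsPoints fun F hF => ?_
  have habs := ApproximatelyAbsorbsPoints.absorbsPoints hF F.isClosed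
  have : CompleteSpace F := F.isClosed.completeSpace_coe
  have : SecondCountableTopology U := UniformSpace.secondCountable_of_separable U
  have : SeparableSpace F := inferInstance
  exact ⟨habs, habs.hasExtensionProperty, habs.hasExtensionProperty.nonempty_isometryEquiv hext⟩
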